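/- Let $1\le r<n$, let $A,E\in\mathbf{R}^{n\times n}$ be symmetric, and let $\lambda_1\ge\dots\ge\lambda_n$ be the eigenvalues of $A$ (with multiplicity), with $\lambda_r>\lambda_{r+1}$. Put $\Lambda_1=\mathrm{diag}(\lambda_1,\dots,\lambda_r)$, $\Lambda_2=\mathrm{diag}(\lambda_{r+1},\dots,\lambda_n)$, and let \[A=V_1\Lambda_1V_1^T+V_2\Lambda_2V_2^T\] be an eigen-decomposition, i.e. $V_1\in\mathbf{R}^{n\times r}$, $V_2\in\mathbf{R}^{n\times(n-r)}$ and $[V_1\ V_2]$ is orthogonal. Let $\|\cdot\|_2$ and $\|\cdot\|_\infty$ denote the matrix norms induced by the $\ell_2$ and $\ell_\infty$ vector norms, $\|\cdot\|_F$ the Frobenius norm, and $\|B\|_{2,\infty}$ the maximum $\ell_2$ norm of a row of $B$. Set \[\mathrm{sep}_2=\inf\{\|Z\Lambda_1-\Lambda_2Z\|_2: Z\in\mathbf{R}^{(n-r)\times r},\ \|Z\|_2=1\},\] \[\mathrm{sep}_{(2,\infty),V_2}=\inf\{\|Z\Lambda_1-V_2\Lambda_2V_2^TZ\|_{2,\infty}: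 Z=V_2X,\ X\in\mathbf{R}^{(n-r)\times r},\ \|Z\|_{2,\infty}=1\},\] \[\mathrm{gap}=\min\{\mathrm{sep}_2,\mathrm{sep}_{(2,\infty),V_2}\},\qquad \mu=\sqrt n\,\|V_1\|_{2,\infty},\qquad E_{2,1}=V_2^TEV_1 .\] Suppose that $\|E\|_2\le \mathrm{gap}/5$ and $\|E\|_\infty\le \mathrm{gap}/(4+4\mu^2)$. Let $\widehat V_1\in\mathbf{R}^{n\times r}$ be any matrix with orthonormal columns whose range is the dominant $r$-dimensional invariant subspace of $A+E$ (the span of orthonormal eigenvectors for its $r$ algebraically largest eigenvalues), and let $\widetilde U$ be any solution of the orthogonal Procrustes problem $\min\{\|\widehat V_1U-V_1\|_F: U\in\mathbf{R}^{r\times r}\text{ orthogonal}\}$. Then \[\|\widehat V_1\widetilde U-V_1\|_{2,\infty}\le 8\|V_1\|_{2,\infty}\left(\frac{\|E_{2,1}\|_2}{\mathrm{sep}_2}\right)^2+4\,\frac{\|V_2E_{2,1}\|_{2,\infty}}{\mathrm{gap}} .\] -/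

import Mathlib

/-! Norms of real matrices, separation of matrices, and split spectral decompositions. -/

noncomputable section

open scoped Matrix.Norms.L2Operator in
/-- The spectral norm `‖B‖₂`, induced by the Euclidean vector norms. -/
def matNormTwo {m k : Type*} [Fintype m] [Fintype k] [DecidableEq k]
    (B : Matrix m k ℝ) : ℝ := ‖B‖

open scoped Matrix.Norms.Operator in
/-- The norm `‖B‖_∞` induced by the sup vector norms (maximal absolute row sum). -/
def matNormInf {m k : Type*} [Fintype m] [Fintype k] (B : Matrix m k ℝ) : ℝ := ‖B‖

open scoped Matrix.Norms.Frobenius in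
/-- The Frobenius norm `‖B‖_F`. -/
def matNormFro {m k : Type*} [Fintype m] [Fintype k] (B : Matrix m k ℝ) : ℝ := ‖B‖

/-- The two-to-infinity norm `‖B‖_{2,∞}`: the largest Euclidean norm of a row of `B`. -/
def matNormTwoInf {m k : Type*} [Fintype k] (B : Matrix m k ℝ) : ℝ :=
  ⨆ i, ‖WithLp.toLp 2 (B i)‖

/-- `sep_N(B, C) = inf {N(ZB - CZ) : N(Z) = 1}` for a norm `N` on matrices. -/
def matSep {l m : Type*} [Fintype l] [Fintype m] (N : Matrix m l ℝ → ℝ)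
    (B : Matrix l l ℝ) (C : Matrix m m ℝ) : ℝ :=
  sInf {x : ℝ | ∃ Z : Matrix m l ℝ, N Z = 1 ∧ x = N (Z * B - C * Z)}

/-- `sep_{N,W}(B, C)`: as `matSep`, but over those `Z` whose columns lie in the range of `W`,
that is, those of the form `Z = W X`. -/
def matSepOn {l m k : Type*} [Fintype l] [Fintype m] [Fintype k] (N : Matrix m l ℝ → ℝ)
    (W : Matrix m k ℝ) (B : Matrix l l ℝ) (C : Matrix m m ℝ) : ℝ :=
  sInf {x : ℝ | ∃ Z : Matrix m l ℝ, (∃ X : Matrix k l ℝ, Z = W * X) ∧ N Z = 1 ∧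
    x = N (Z * B - C * Z)}

/-- `Λ₁ = diag(λ₁, …, λ_r)`. -/
def leadingDiag {n r : ℕ} (h : r ≤ n) (lam : Fin n → ℝ) : Matrix (Fin r) (Fin r) ℝ :=
  Matrix.diagonal fun i => lam (Fin.castLE h i)

/-- `Λ₂ = diag(λ_{r+1}, …, λ_n)`. -/
def trailingDiag {n : ℕ} (r : ℕ) (lam : Fin n → ℝ) :
    Matrix (Fin (n - r)) (Fin (n - r)) ℝ :=
  Matrix.diagonal fun j => lam ⟨r + j.val, by have := j.isLt; omega⟩

/-- `A = V₁ Λ₁ V₁ᵀ + V₂ Λ₂ V₂ᵀ` is an eigen-decomposition of `A`: the eigenvalues `lam` are in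
descending order (with multiplicity) and the columns of `V₁` and `V₂` together are orthonormal. -/
structure IsEigenSplit {n r : ℕ} (h : r ≤ n) (A : Matrix (Fin n) (Fin n) ℝ) (lam : Fin n → ℝ)
    (V₁ : Matrix (Fin n) (Fin r) ℝ) (V₂ : Matrix (Fin n) (Fin (n - r)) ℝ) : Prop where
  antitone : Antitone lam
  orthonormal₁ : V₁.transpose * V₁ = 1
  orthonormal₂ : V₂.transpose * V₂ = 1
  orthogonal : V₁.transpose * V₂ = 0
  decomp : A = V₁ * leadingDiag h lam * V₁.transpose + V₂ * trailingDiag r lam * V₂.transpose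

/-- The matrix `W` has orthonormal columns, and its range is a dominant `r`-dimensional invariant
subspace of the symmetric matrix `B`, i.e. the span of `r` orthonormal eigenvectors belonging to
the `r` algebraically largest eigenvalues (unique if the `r`-th and `(r+1)`-st eigenvalues of `B`
differ, which is not assumed here). -/
def IsDominantBasis {n r : ℕ} (h : r ≤ n) (B : Matrix (Fin n) (Fin n) ℝ)
    (W : Matrix (Fin n) (Fin r) ℝ) : Prop :=
  W.transpose * W = 1 ∧
    ∃ (lam : Fin n → ℝ) (W₁ : Matrix (Fin n) (Fin r) ℝ) (W₂ : Matrix (Fin n) (Fin (n - r)) ℝ),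
      IsEigenSplit h B lam W₁ W₂ ∧
        LinearMap.range W.mulVecLin = LinearMap.range W₁.mulVecLin

/-- `U` solves the orthogonal Procrustes problem `min {‖W U - V‖_F : U orthogonal}`. -/
def IsProcrustesSolution {n r : ℕ} (W V : Matrix (Fin n) (Fin r) ℝ)
    (U : Matrix (Fin r) (Fin r) ℝ) : Prop :=
  U ∈ Matrix.orthogonalGroup (Fin r) ℝ ∧
    ∀ Q ∈ Matrix.orthogonalGroup (Fin r) ℝ, matNormFro (W * U - V) ≤ matNormFro (W * Q - V)

/-- `gap = min {sep₂(Λ₁, Λ₂), sep_{(2,∞),V₂}(Λ₁, V₂ Λ₂ V₂ᵀ)}`. -/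
def spectralGap {n r : ℕ} (h : r ≤ n) (lam : Fin n → ℝ)
    (V₂ : Matrix (Fin n) (Fin (n - r)) ℝ) : ℝ :=
  min (matSep matNormTwo (leadingDiag h lam) (trailingDiag r lam))
    (matSepOn matNormTwoInf V₂ (leadingDiag h lam) (V₂ * trailingDiag r lam * V₂.transpose))

end

/-!
The matrix `W` of the perturbed dominant eigenvectors is split into its blocks `C = V₁ᵀ W` and
`S = V₂ᵀ W`. Since `(A + E) W = W M`, they satisfy the Sylvester equation `S M - Λ₂ S = V₂ᵀ E W`.
By Weyl's inequality (`IsEigenSplit.le_eigenvalue`) the quadratic form of `M` is at least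
`λ_r - ‖E‖₂`, so the lower bound for Sylvester operators (`mul_matNormTwo_le_sylvester`) gives
`‖S‖₂ ≤ 1/4`. Hence `C` is invertible and the perturbed subspace is the graph of `X = S C⁻¹`, with
`‖X‖₂ ≤ 1/2` (`IsEigenSplit.exists_graph`).

The matrix `X` solves the Riccati equation
`X Λ₁ - Λ₂ X = E₂₁ + E₂₂ X - X E₁₁ - X E₁₂ X`, where `Eᵢⱼ = Vᵢᵀ E Vⱼ` (`IsEigenSplit.riccati`).
The a priori bound on `‖X‖₂` makes the terms on the right that contain `X` small, also in the
two-to-infinity norm, because `‖V₂ X E₁₂ X‖_{2,∞} ≤ ‖V₂ X‖_{2,∞} ‖E₁₂‖₂ ‖X‖₂`. They are absorbed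
into the left side, and what remains is `‖X‖₂ ≤ 2 ‖E₂₁‖₂ / sep₂` (`IsEigenSplit.graph_norm_le`) and
`‖V₂ X‖_{2,∞} ≤ 4 ‖V₂ E₂₁‖_{2,∞} / gap` (`IsEigenSplit.graph_rows_le`).

Finally, optimality of the Procrustes solution `U` forces `P = C U` to be positive semidefinite
(`posSemidef_of_trace_mul_le`). In `W U - V₁ = V₁ (P - 1) + V₂ X P` the first term is of second
order, as `1 - P² = (X P)ᵀ (X P)` (`IsEigenSplit.procrustes_error_le`).
-/

open scoped Matrix

/-! ### The spectral norm and the Sylvester operator -/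

theorem dotProduct_self_eq_norm_toLp_sq {k : Type*} [Fintype k] (x : k → ℝ) :
    x ⬝ᵥ x = ‖WithLp.toLp 2 x‖ ^ 2 := by
  rw [EuclideanSpace.norm_sq_eq]
  simp [dotProduct, sq]

theorem abs_dotProduct_le {k : Type*} [Fintype k] (x y : k → ℝ) :
    |x ⬝ᵥ y| ≤ ‖WithLp.toLp 2 x‖ * ‖WithLp.toLp 2 y‖ := by
  have h := abs_real_inner_le_norm (WithLp.toLp 2 y) (WithLp.toLp 2 x)
  rwa [EuclideanSpace.inner_toLp_toLp, star_trivial, mul_comm] at h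

/-- A matrix whose quadratic form is at least `c` stretches every vector by at least `c`. -/
theorem mul_norm_le_norm_mulVec {k : Type*} [Fintype k] {B : Matrix k k ℝ} {c : ℝ}
    (h : ∀ x : k → ℝ, c * (x ⬝ᵥ x) ≤ x ⬝ᵥ B *ᵥ x) (x : k → ℝ) :
    c * ‖WithLp.toLp 2 x‖ ≤ ‖WithLp.toLp 2 (B *ᵥ x)‖ := by
  have h1 := (h x).trans ((le_abs_self _).trans (abs_dotProduct_le x (B *ᵥ x)))
  rw [dotProduct_self_eq_norm_toLp_sq] at h1
  rcases (norm_nonneg (WithLp.toLp 2 x)).eq_or_lt with h0 | h0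
  · rw [← h0]; simp
  · refine le_of_mul_le_mul_left ?_ h0
    nlinarith

section SpectralNorm

variable {k l m : Type*} [Fintype k] [Fintype l] [Fintype m]
variable [DecidableEq k] [DecidableEq l]

open scoped Matrix.Norms.L2Operator in
theorem norm_toLp_mulVec_le (B : Matrix m k ℝ) (x : k → ℝ) :
    ‖WithLp.toLp 2 (B *ᵥ x)‖ ≤ matNormTwo B * ‖WithLp.toLp 2 x‖ :=
  B.l2_opNorm_mulVec (WithLp.toLp 2 x)

open scoped Matrix.Norms.L2Operator in
theorem matNormTwo_le_of_forall {B : Matrix m k ℝ} {c : ℝ} (hc : 0 ≤ c)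
    (h : ∀ x : k → ℝ, ‖WithLp.toLp 2 (B *ᵥ x)‖ ≤ c * ‖WithLp.toLp 2 x‖) :
    matNormTwo B ≤ c := by
  unfold matNormTwo
  rw [Matrix.l2_opNorm_def]
  exact ContinuousLinearMap.opNorm_le_bound _ hc fun x => h x.ofLp

open scoped Matrix.Norms.L2Operator in
theorem matNormTwo_nonneg (B : Matrix m k ℝ) : 0 ≤ matNormTwo B := norm_nonneg _

open scoped Matrix.Norms.L2Operator in
theorem matNormTwo_mul_le (B : Matrix m k ℝ) (C : Matrix k l ℝ) :
    matNormTwo (B * C) ≤ matNormTwo B * matNormTwo C := Matrix.l2_opNorm_mul B C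

open scoped Matrix.Norms.L2Operator in
theorem matNormTwo_transpose [DecidableEq m] (B : Matrix m k ℝ) : matNormTwo Bᵀ = matNormTwo B := by
  rw [← Matrix.conjTranspose_eq_transpose_of_trivial]
  exact Matrix.l2_opNorm_conjTranspose B

open scoped Matrix.Norms.L2Operator in
theorem matNormTwo_transpose_mul_self (B : Matrix m k ℝ) :
    matNormTwo (Bᵀ * B) = matNormTwo B ^ 2 := by
  rw [← Matrix.conjTranspose_eq_transpose_of_trivial, sq]
  exact Matrix.l2_opNorm_conjTranspose_mul_self B

open scoped Matrix.Norms.L2Operator in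
theorem matNormTwo_add_le (B C : Matrix m k ℝ) :
    matNormTwo (B + C) ≤ matNormTwo B + matNormTwo C := norm_add_le B C

open scoped Matrix.Norms.L2Operator in
theorem matNormTwo_sub_le (B C : Matrix m k ℝ) :
    matNormTwo (B - C) ≤ matNormTwo B + matNormTwo C := norm_sub_le B C

open scoped Matrix.Norms.L2Operator in
theorem matNormTwo_smul (c : ℝ) (B : Matrix m k ℝ) :
    matNormTwo (c • B) = |c| * matNormTwo B := norm_smul c B

open scoped Matrix.Norms.L2Operator in
theorem matNormTwo_eq_zero {B : Matrix m k ℝ} : matNormTwo B = 0 ↔ B = 0 := norm_eq_zero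

open scoped Matrix.Norms.L2Operator in
theorem matNormTwo_diagonal_le {d : k → ℝ} {c : ℝ} (hc : 0 ≤ c) (h : ∀ i, |d i| ≤ c) :
    matNormTwo (Matrix.diagonal d) ≤ c := by
  unfold matNormTwo
  rw [Matrix.l2_opNorm_diagonal]
  exact (pi_norm_le_iff_of_nonneg hc).2 h

open scoped Matrix.Norms.L2Operator in
theorem matNormTwo_single_one [DecidableEq m] (i : m) (j : k) :
    matNormTwo (Matrix.single i j (1 : ℝ)) = 1 := by
  have h := matNormTwo_transpose_mul_self (Matrix.single i j (1 : ℝ))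
  have hd : (Matrix.single i j (1 : ℝ))ᵀ * Matrix.single i j (1 : ℝ)
      = Matrix.diagonal (Pi.single j 1) := by
    rw [Matrix.transpose_single, Matrix.single_mul_single_same, Matrix.diagonal_single, one_mul]
  have h1 : matNormTwo (Matrix.diagonal (Pi.single j (1 : ℝ))) = 1 := by
    unfold matNormTwo
    rw [Matrix.l2_opNorm_diagonal, Pi.norm_single, norm_one]
  rw [hd, h1] at h
  exact (sq_eq_sq₀ (matNormTwo_nonneg _) zero_le_one).1 (by rw [← h]; norm_num)

theorem matNormTwo_one_le : matNormTwo (1 : Matrix k k ℝ) ≤ 1 := by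
  rw [← Matrix.diagonal_one]
  exact matNormTwo_diagonal_le zero_le_one fun i => by simp

/-- A matrix with orthonormal columns is a contraction. -/
theorem matNormTwo_le_one_of_transpose_mul_self {V : Matrix m k ℝ} (h : Vᵀ * V = 1) :
    matNormTwo V ≤ 1 := by
  have h1 := matNormTwo_transpose_mul_self V
  rw [h] at h1
  have h2 := matNormTwo_one_le (k := k)
  nlinarith [matNormTwo_nonneg V]

/-- Lower bound for the Sylvester operator `S ↦ S M - D S` when the quadratic form of `M` lies
above `a` and the diagonal of `D` lies below `b`. Adding a large multiple `t` of the identity to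
both `M` and `D` does not change the operator; then `M + t` is expanding by `a + t`, and `D + t`
has norm at most `b + t`. -/
theorem mul_matNormTwo_le_sylvester [DecidableEq m] {M : Matrix k k ℝ} {d : m → ℝ} {a b : ℝ}
    (hM : ∀ x : k → ℝ, a * (x ⬝ᵥ x) ≤ x ⬝ᵥ M *ᵥ x) (hd : ∀ i, d i ≤ b) (S : Matrix m k ℝ) :
    (a - b) * matNormTwo S ≤ matNormTwo (S * M - Matrix.diagonal d * S) := by
  obtain ⟨t, hta, htb, ht⟩ : ∃ t : ℝ, 0 < a + t ∧ 0 ≤ b + t ∧ ∀ i, 0 ≤ d i + t := by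
    refine ⟨|a| + |b| + 1 + ∑ i, |d i|, ?_, ?_, fun i => ?_⟩ <;>
      have h0 : 0 ≤ ∑ i, |d i| := Finset.sum_nonneg fun i _ => abs_nonneg _
    · linarith [neg_abs_le a, abs_nonneg b]
    · linarith [neg_abs_le b, abs_nonneg a]
    · have := Finset.single_le_sum (f := fun i => |d i|) (fun i _ => abs_nonneg _)
        (Finset.mem_univ i)
      linarith [neg_abs_le (d i), abs_nonneg a, abs_nonneg b]
  have hMt : ∀ x : k → ℝ, (a + t) * (x ⬝ᵥ x) ≤ x ⬝ᵥ (M + t • 1)ᵀ *ᵥ x := by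
    intro x
    have : x ⬝ᵥ (M + t • 1)ᵀ *ᵥ x = x ⬝ᵥ M *ᵥ x + t * (x ⬝ᵥ x) := by
      rw [Matrix.mulVec_transpose, dotProduct_comm, ← Matrix.dotProduct_mulVec, Matrix.add_mulVec,
        Matrix.smul_mulVec, Matrix.one_mulVec, dotProduct_add, dotProduct_smul, smul_eq_mul]
    rw [this]; linarith [hM x]
  have h1 : (a + t) * matNormTwo S ≤ matNormTwo (S * (M + t • 1)) := by
    rw [← matNormTwo_transpose S, ← matNormTwo_transpose (S * _), ← le_div_iff₀' hta]
    refine matNormTwo_le_of_forall (div_nonneg (matNormTwo_nonneg _) hta.le) fun x => ?_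
    rw [div_mul_eq_mul_div, le_div_iff₀' hta]
    refine (mul_norm_le_norm_mulVec hMt (Sᵀ *ᵥ x)).trans ?_
    rw [Matrix.mulVec_mulVec, ← Matrix.transpose_mul]
    exact norm_toLp_mulVec_le _ x
  have h2 : S * (M + t • 1)
      = (S * M - Matrix.diagonal d * S) + Matrix.diagonal (fun i => d i + t) * S := by
    have : Matrix.diagonal (fun i => d i + t) = Matrix.diagonal d + t • (1 : Matrix m m ℝ) := by
      rw [Matrix.smul_one_eq_diagonal, Matrix.diagonal_add]
    rw [this, Matrix.mul_add, Matrix.add_mul, Matrix.mul_smul, Matrix.smul_mul, Matrix.mul_one,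
      Matrix.one_mul]
    abel
  have h3 : matNormTwo (Matrix.diagonal (fun i => d i + t) * S) ≤ (b + t) * matNormTwo S := by
    refine (matNormTwo_mul_le _ _).trans
      (mul_le_mul_of_nonneg_right (matNormTwo_diagonal_le htb fun i => ?_) (matNormTwo_nonneg _))
    rw [abs_of_nonneg (ht i)]
    linarith [hd i]
  rw [h2] at h1
  linarith [matNormTwo_add_le (S * M - Matrix.diagonal d * S)
    (Matrix.diagonal (fun i => d i + t) * S)]

end SpectralNorm

/-! ### The two-to-infinity norm and the maximal row sum -/

section TwoInf

variable {k l m : Type*} [Fintype k] [Fintype l]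

theorem matNormTwoInf_nonneg (B : Matrix m k ℝ) : 0 ≤ matNormTwoInf B :=
  Real.iSup_nonneg fun _ => norm_nonneg _

theorem norm_row_le_matNormTwoInf [Fintype m] (B : Matrix m k ℝ) (i : m) :
    ‖WithLp.toLp 2 (B i)‖ ≤ matNormTwoInf B :=
  le_ciSup (f := fun i => ‖WithLp.toLp 2 (B i)‖) (Set.finite_range _).bddAbove i

theorem matNormTwoInf_le {B : Matrix m k ℝ} {c : ℝ} (hc : 0 ≤ c)
    (h : ∀ i, ‖WithLp.toLp 2 (B i)‖ ≤ c) : matNormTwoInf B ≤ c :=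
  Real.iSup_le h hc

theorem matNormTwoInf_add_le [Fintype m] (B C : Matrix m k ℝ) :
    matNormTwoInf (B + C) ≤ matNormTwoInf B + matNormTwoInf C :=
  matNormTwoInf_le (add_nonneg (matNormTwoInf_nonneg _) (matNormTwoInf_nonneg _)) fun i =>
    (norm_add_le (WithLp.toLp 2 (B i)) (WithLp.toLp 2 (C i))).trans
      (add_le_add (norm_row_le_matNormTwoInf B i) (norm_row_le_matNormTwoInf C i))

theorem matNormTwoInf_neg (B : Matrix m k ℝ) : matNormTwoInf (-B) = matNormTwoInf B := by
  unfold matNormTwoInf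
  congr 1; funext i
  exact norm_neg (WithLp.toLp 2 (B i))

theorem matNormTwoInf_smul (c : ℝ) (B : Matrix m k ℝ) :
    matNormTwoInf (c • B) = |c| * matNormTwoInf B := by
  unfold matNormTwoInf
  rw [Real.mul_iSup_of_nonneg (abs_nonneg c)]
  congr 1; funext i
  exact norm_smul c (WithLp.toLp 2 (B i))

theorem matNormTwoInf_mul_le_mul_matNormTwo [Fintype m] [DecidableEq k] [DecidableEq l]
    (B : Matrix m k ℝ) (C : Matrix k l ℝ) :
    matNormTwoInf (B * C) ≤ matNormTwoInf B * matNormTwo C := by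
  refine matNormTwoInf_le (mul_nonneg (matNormTwoInf_nonneg _) (matNormTwo_nonneg _)) fun i => ?_
  have h : (B * C) i = Cᵀ *ᵥ B i := by
    rw [Matrix.mul_apply_eq_vecMul, Matrix.mulVec_transpose]
  rw [h, mul_comm, ← matNormTwo_transpose C]
  exact (norm_toLp_mulVec_le _ _).trans
    (mul_le_mul_of_nonneg_left (norm_row_le_matNormTwoInf B i) (matNormTwo_nonneg _))

open scoped Matrix.Norms.Operator in
theorem sum_abs_row_le_matNormInf [Fintype m] (G : Matrix m k ℝ) (i : m) :
    ∑ j, |G i j| ≤ matNormInf G := by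
  unfold matNormInf
  rw [Matrix.linfty_opNorm_def]
  have := Finset.le_sup (f := fun i => ∑ j, ‖G i j‖₊) (Finset.mem_univ i)
  have h2 := NNReal.coe_le_coe.2 this
  simpa using h2

open scoped Matrix.Norms.Operator in
theorem matNormInf_nonneg [Fintype m] (G : Matrix m k ℝ) : 0 ≤ matNormInf G := norm_nonneg _

open scoped Matrix.Norms.Operator in
theorem matNormInf_le [Fintype m] {G : Matrix m k ℝ} {c : ℝ} (hc : 0 ≤ c) (h :
    ∀ i, ∑ j, |G i j| ≤ c) :
    matNormInf G ≤ c := by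
  unfold matNormInf
  rw [Matrix.linfty_opNorm_def]
  lift c to NNReal using hc
  refine NNReal.coe_le_coe.2 (Finset.sup_le fun i _ => ?_)
  rw [← NNReal.coe_le_coe]
  simpa using h i

open scoped Matrix.Norms.Operator in
theorem matNormInf_mul_le [Fintype m] (G : Matrix m k ℝ) (H : Matrix k l ℝ) :
    matNormInf (G * H) ≤ matNormInf G * matNormInf H := Matrix.linfty_opNorm_mul G H

open scoped Matrix.Norms.Operator in
theorem matNormInf_sub_le [Fintype m] (G H : Matrix m k ℝ) :
    matNormInf (G - H) ≤ matNormInf G + matNormInf H := norm_sub_le G H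

theorem matNormTwoInf_mul_le_matNormInf_mul [Fintype m] (G : Matrix m k ℝ) (Z : Matrix k l ℝ) :
    matNormTwoInf (G * Z) ≤ matNormInf G * matNormTwoInf Z := by
  refine matNormTwoInf_le (mul_nonneg (matNormInf_nonneg _) (matNormTwoInf_nonneg _)) fun i => ?_
  have h : WithLp.toLp 2 ((G * Z) i) = ∑ j, G i j • WithLp.toLp 2 (Z j) := by
    ext c
    simp [Matrix.mul_apply]
  rw [h]
  calc _ ≤ ∑ j, |G i j| * matNormTwoInf Z := by
        refine (norm_sum_le _ _).trans (Finset.sum_le_sum fun j _ => ?_)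
        rw [norm_smul, Real.norm_eq_abs]
        exact mul_le_mul_of_nonneg_left (norm_row_le_matNormTwoInf Z j) (abs_nonneg _)
    _ ≤ _ := by
        rw [← Finset.sum_mul]
        exact mul_le_mul_of_nonneg_right (sum_abs_row_le_matNormInf G i) (matNormTwoInf_nonneg _)

theorem matNormInf_mul_transpose_self_le [Fintype m] [DecidableEq k] (V : Matrix m k ℝ) :
    matNormInf (V * Vᵀ) ≤ (Real.sqrt (Fintype.card m) * matNormTwoInf V) ^ 2 := by
  refine matNormInf_le (sq_nonneg _) fun i => ?_
  rw [mul_pow, Real.sq_sqrt (Nat.cast_nonneg _)]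
  have h : ∀ j ∈ Finset.univ, |(V * Vᵀ) i j| ≤ matNormTwoInf V ^ 2 := fun j _ => by
    rw [sq]
    exact (abs_dotProduct_le (V i) (V j)).trans
      (mul_le_mul (norm_row_le_matNormTwoInf V i) (norm_row_le_matNormTwoInf V j)
        (norm_nonneg _) (matNormTwoInf_nonneg _))
  refine (Finset.sum_le_card_nsmul _ _ _ h).trans_eq ?_
  rw [nsmul_eq_mul, Finset.card_univ]

end TwoInf

/-! ### Quadratic forms -/

theorem dotProduct_mulVec_diagonal {k : Type*} [Fintype k] [DecidableEq k] (d x : k → ℝ) :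
    x ⬝ᵥ Matrix.diagonal d *ᵥ x = ∑ i, d i * x i ^ 2 := by
  simp only [dotProduct, Matrix.mulVec_diagonal]
  exact Finset.sum_congr rfl fun i _ => by ring

theorem mul_dotProduct_le_diagonal {k : Type*} [Fintype k] [DecidableEq k] {d : k → ℝ} {a : ℝ}
    (h : ∀ i, a ≤ d i) (x : k → ℝ) : a * (x ⬝ᵥ x) ≤ x ⬝ᵥ Matrix.diagonal d *ᵥ x := by
  rw [dotProduct_mulVec_diagonal, dotProduct, Finset.mul_sum]
  refine Finset.sum_le_sum fun i _ => ?_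
  rw [← sq]
  exact mul_le_mul_of_nonneg_right (h i) (sq_nonneg _)

theorem dotProduct_mulVec_conj {m k : Type*} [Fintype m] [Fintype k] (W : Matrix m k ℝ)
    (B : Matrix k k ℝ) (x : m → ℝ) :
    x ⬝ᵥ (W * B * Wᵀ) *ᵥ x = (Wᵀ *ᵥ x) ⬝ᵥ B *ᵥ (Wᵀ *ᵥ x) := by
  rw [← Matrix.mulVec_mulVec, ← Matrix.mulVec_mulVec, Matrix.dotProduct_mulVec,
    ← Matrix.mulVec_transpose]

theorem mulVec_dotProduct_mulVec_self {m k : Type*} [Fintype m] [Fintype k] [DecidableEq k]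
    {W : Matrix m k ℝ} (h : Wᵀ * W = 1) (x : k → ℝ) : (W *ᵥ x) ⬝ᵥ (W *ᵥ x) = x ⬝ᵥ x := by
  rw [Matrix.dotProduct_mulVec, ← Matrix.mulVec_transpose, Matrix.mulVec_mulVec, h,
    Matrix.one_mulVec]

/-! ### Spectral decompositions and Weyl's inequality -/

section EigenSplit

variable {n r : ℕ} {h : r ≤ n} {A : Matrix (Fin n) (Fin n) ℝ} {lam : Fin n → ℝ}
  {V₁ : Matrix (Fin n) (Fin r) ℝ} {V₂ : Matrix (Fin n) (Fin (n - r)) ℝ}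

theorem IsEigenSplit.transpose_mul_eq_zero (hs : IsEigenSplit h A lam V₁ V₂) : V₂ᵀ * V₁ = 0 := by
  rw [← Matrix.transpose_transpose V₁, ← Matrix.transpose_mul, hs.orthogonal,
    Matrix.transpose_zero]

theorem IsEigenSplit.mul_transpose_add (hs : IsEigenSplit h A lam V₁ V₂) :
    V₁ * V₁ᵀ + V₂ * V₂ᵀ = 1 := by
  rw [← Matrix.fromCols_mul_fromRows]
  refine (Matrix.mul_eq_one_comm_of_card_eq _ _ _ ?_).1 ?_
  · simp [h]
  · rw [Matrix.fromRows_mul_fromCols, hs.orthonormal₁, hs.orthonormal₂, hs.orthogonal,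
      hs.transpose_mul_eq_zero, Matrix.fromBlocks_one]

theorem IsEigenSplit.mul_leading (hs : IsEigenSplit h A lam V₁ V₂) :
    A * V₁ = V₁ * leadingDiag h lam := by
  rw [hs.decomp, Matrix.add_mul, Matrix.mul_assoc _ V₂ᵀ, hs.transpose_mul_eq_zero,
    Matrix.mul_assoc _ V₁ᵀ, hs.orthonormal₁, Matrix.mul_zero, add_zero, Matrix.mul_one]

theorem IsEigenSplit.transpose_mul_trailing (hs : IsEigenSplit h A lam V₁ V₂) :
    V₂ᵀ * A = trailingDiag r lam * V₂ᵀ := by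
  rw [hs.decomp, Matrix.mul_add, ← Matrix.mul_assoc V₂ᵀ, ← Matrix.mul_assoc V₂ᵀ V₁,
    hs.transpose_mul_eq_zero, ← Matrix.mul_assoc V₂ᵀ, ← Matrix.mul_assoc V₂ᵀ V₂, hs.orthonormal₂,
    Matrix.zero_mul, Matrix.zero_mul, zero_add, Matrix.one_mul]

theorem IsEigenSplit.transpose_mul_leading (hs : IsEigenSplit h A lam V₁ V₂) :
    V₁ᵀ * A = leadingDiag h lam * V₁ᵀ := by
  rw [hs.decomp, Matrix.mul_add, ← Matrix.mul_assoc V₁ᵀ, ← Matrix.mul_assoc V₁ᵀ V₁,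
    hs.orthonormal₁, ← Matrix.mul_assoc V₁ᵀ, ← Matrix.mul_assoc V₁ᵀ V₂, hs.orthogonal,
    Matrix.zero_mul, Matrix.zero_mul, add_zero, Matrix.one_mul]

theorem le_leadingDiag_entry (hl : Antitone lam) (hr : r - 1 < n)
    (i : Fin r) : lam ⟨r - 1, hr⟩ ≤ lam (Fin.castLE h i) :=
  hl (by rw [Fin.le_def]; simp; omega)

theorem trailingDiag_entry_le (hl : Antitone lam) (hr : r < n)
    (j : Fin (n - r)) (hj : r + j.val < n) : lam ⟨r + j.val, hj⟩ ≤ lam ⟨r, hr⟩ :=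
  hl (by rw [Fin.le_def]; simp)

/-- The Sylvester operator of `Λ₁` and `Λ₂` is bounded below by the eigenvalue gap, and the matrix
unit pairing `λ_r` with `λ_{r+1}` attains this bound. -/
theorem matSep_matNormTwo_eq (hl : Antitone lam) (hr : 0 < r) (hrn : r < n)
    (hr' : r - 1 < n) :
    matSep matNormTwo (leadingDiag hrn.le lam) (trailingDiag r lam)
      = lam ⟨r - 1, hr'⟩ - lam ⟨r, hrn⟩ := by
  have hmem : lam ⟨r - 1, hr'⟩ - lam ⟨r, hrn⟩ ∈ {x : ℝ | ∃ Z : Matrix (Fin (n - r)) (Fin r) ℝ,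
      matNormTwo Z = 1 ∧
        x = matNormTwo (Z * leadingDiag hrn.le lam - trailingDiag r lam * Z)} := by
    let i₀ : Fin (n - r) := ⟨0, by omega⟩
    let j₀ : Fin r := ⟨r - 1, by omega⟩
    refine ⟨Matrix.single i₀ j₀ 1, matNormTwo_single_one _ _, ?_⟩
    have : Matrix.single i₀ j₀ (1 : ℝ) * leadingDiag hrn.le lam
        - trailingDiag r lam * Matrix.single i₀ j₀ (1 : ℝ)
        = (lam ⟨r - 1, hr'⟩ - lam ⟨r, hrn⟩) • Matrix.single i₀ j₀ (1 : ℝ) := by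
      ext i j
      rw [Matrix.sub_apply, leadingDiag, trailingDiag, Matrix.mul_diagonal, Matrix.diagonal_mul,
        Matrix.smul_apply, smul_eq_mul]
      by_cases hij : i₀ = i ∧ j₀ = j
      · obtain ⟨rfl, rfl⟩ := hij
        simp [i₀, j₀, Fin.castLE]
      · rw [Matrix.single_apply_of_ne _ _ _ _ _ hij]; ring
    rw [this, matNormTwo_smul, matNormTwo_single_one, mul_one, abs_of_nonneg]
    exact sub_nonneg.2 (hl (by rw [Fin.le_def]; simp))
  refine le_antisymm (csInf_le ⟨0, ?_⟩ hmem) (le_csInf ⟨_, hmem⟩ ?_)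
  · rintro x ⟨Z, -, rfl⟩
    exact matNormTwo_nonneg _
  · rintro x ⟨Z, hZ, rfl⟩
    have := mul_matNormTwo_le_sylvester
      (mul_dotProduct_le_diagonal fun i => le_leadingDiag_entry (h := hrn.le) hl hr' i)
      (fun j => trailingDiag_entry_le hl hrn j (by omega)) Z
    rwa [hZ, mul_one] at this

/-- A lower bound of Weyl type: if `B` is at least `a` on an `r`-dimensional subspace, then so is
its `r`-th eigenvalue. By counting dimensions, that subspace contains a nonzero vector orthogonal to
the first `r - 1` eigenvectors. -/
theorem IsEigenSplit.le_eigenvalue {hrn : r ≤ n} {B : Matrix (Fin n) (Fin n) ℝ}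
    {W₁ : Matrix (Fin n) (Fin r) ℝ} {W₂ : Matrix (Fin n) (Fin (n - r)) ℝ}
    (hs : IsEigenSplit hrn B lam W₁ W₂) (hr : 0 < r) (hr' : r - 1 < n)
    {V : Matrix (Fin n) (Fin r) ℝ} (hV : Vᵀ * V = 1) {a : ℝ}
    (ha : ∀ x : Fin r → ℝ, a * (x ⬝ᵥ x) ≤ (V *ᵥ x) ⬝ᵥ B *ᵥ (V *ᵥ x)) :
    a ≤ lam ⟨r - 1, hr'⟩ := by
  let f : (Fin r → ℝ) →ₗ[ℝ] (Fin (r - 1) → ℝ) :=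
    (LinearMap.funLeft ℝ ℝ (Fin.castLE (Nat.sub_le r 1))).comp (W₁ᵀ * V).mulVecLin
  have hker := f.ker_ne_bot_of_finrank_lt (by
    rw [Module.finrank_fin_fun, Module.finrank_fin_fun]; omega)
  obtain ⟨x, hx, hx0⟩ := (Submodule.ne_bot_iff _).1 hker
  set y := V *ᵥ x with hy
  have hxx : 0 < x ⬝ᵥ x := by
    rw [dotProduct_self_eq_norm_toLp_sq]
    have : WithLp.toLp 2 x ≠ 0 := fun h => hx0 ((WithLp.toLp_eq_zero 2).1 h)
    positivity
  have hy1 : ∀ i : Fin r, i.val < r - 1 → (W₁ᵀ *ᵥ y) i = 0 := fun i hi => by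
    have := congrFun (LinearMap.mem_ker.1 hx) ⟨i.val, hi⟩
    rwa [LinearMap.comp_apply, LinearMap.funLeft_apply, Matrix.mulVecLin_apply,
      ← Matrix.mulVec_mulVec] at this
  have hyy : (W₁ᵀ *ᵥ y) ⬝ᵥ (W₁ᵀ *ᵥ y) + (W₂ᵀ *ᵥ y) ⬝ᵥ (W₂ᵀ *ᵥ y) = x ⬝ᵥ x := by
    have h1 := dotProduct_mulVec_conj W₁ 1 y
    have h2 := dotProduct_mulVec_conj W₂ 1 y
    rw [Matrix.mul_one, Matrix.one_mulVec] at h1 h2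
    rw [← h1, ← h2, ← dotProduct_add, ← Matrix.add_mulVec, hs.mul_transpose_add,
      Matrix.one_mulVec, mulVec_dotProduct_mulVec_self hV]
  have hB : y ⬝ᵥ B *ᵥ y ≤ lam ⟨r - 1, hr'⟩ * (x ⬝ᵥ x) := by
    have hdec := congrArg (fun M => y ⬝ᵥ M *ᵥ y) hs.decomp
    simp only [Matrix.add_mulVec, dotProduct_add, dotProduct_mulVec_conj, leadingDiag,
      trailingDiag, dotProduct_mulVec_diagonal] at hdec
    rw [hdec, ← hyy, mul_add, dotProduct, dotProduct, Finset.mul_sum, Finset.mul_sum]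
    refine add_le_add (Finset.sum_le_sum fun i _ => ?_) (Finset.sum_le_sum fun j _ => ?_) <;>
      rw [← sq]
    · by_cases hi : i.val < r - 1
      · rw [hy1 i hi]; simp
      · refine mul_le_mul_of_nonneg_right (hs.antitone ?_) (sq_nonneg _)
        rw [Fin.le_def]; simp; omega
    · refine mul_le_mul_of_nonneg_right (hs.antitone ?_) (sq_nonneg _)
      rw [Fin.le_def]; simp; omega
  exact le_of_mul_le_mul_right ((ha x).trans hB) hxx

/-- A dominant basis `W` of `B` satisfies `B W = W M`, where the quadratic form of `M` is at least
any lower bound for `B` on some `r`-dimensional subspace. -/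
theorem IsDominantBasis.exists_mul_eq {hrn : r ≤ n} {B : Matrix (Fin n) (Fin n) ℝ}
    {W : Matrix (Fin n) (Fin r) ℝ} (hW : IsDominantBasis hrn B W) (hr : 0 < r)
    {V : Matrix (Fin n) (Fin r) ℝ} (hV : Vᵀ * V = 1) {a : ℝ}
    (ha : ∀ x : Fin r → ℝ, a * (x ⬝ᵥ x) ≤ (V *ᵥ x) ⬝ᵥ B *ᵥ (V *ᵥ x)) :
    ∃ M : Matrix (Fin r) (Fin r) ℝ, B * W = W * M ∧
      ∀ x : Fin r → ℝ, a * (x ⬝ᵥ x) ≤ x ⬝ᵥ M *ᵥ x := by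
  obtain ⟨hWW, lam, W₁, W₂, hs, hrange⟩ := hW
  have hr' : r - 1 < n := by omega
  have hlam := hs.le_eigenvalue hr hr' hV ha
  have hcol : ∀ j, ∃ z, W₁ *ᵥ z = W *ᵥ Pi.single j 1 := fun j => by
    have : W *ᵥ Pi.single j 1 ∈ LinearMap.range W₁.mulVecLin := by
      rw [← hrange]; exact ⟨_, rfl⟩
    exact this
  choose z hz using hcol
  obtain ⟨O, hO⟩ : ∃ O : Matrix (Fin r) (Fin r) ℝ, W = W₁ * O := by
    refine ⟨Matrix.of fun i j => z j i, ?_⟩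
    ext i j
    have := congrFun (hz j) i
    rw [Matrix.mulVec_single_one] at this
    exact this.symm
  have hOO : Oᵀ * O = 1 := by
    rw [hO, Matrix.transpose_mul, Matrix.mul_assoc, ← Matrix.mul_assoc W₁ᵀ, hs.orthonormal₁,
      Matrix.one_mul] at hWW
    exact hWW
  have hOO' : O * Oᵀ = 1 := mul_eq_one_comm.1 hOO
  refine ⟨Oᵀ * leadingDiag hrn lam * O, ?_, fun x => ?_⟩
  · rw [hO, ← Matrix.mul_assoc, hs.mul_leading]
    calc W₁ * leadingDiag hrn lam * O = W₁ * (O * Oᵀ) * leadingDiag hrn lam * O := by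
          rw [hOO', Matrix.mul_one]
      _ = _ := by simp only [Matrix.mul_assoc]
  · have h1 := dotProduct_mulVec_conj Oᵀ (leadingDiag hrn lam) x
    rw [Matrix.transpose_transpose] at h1
    rw [h1, ← mulVec_dotProduct_mulVec_self hOO x]
    exact mul_dotProduct_le_diagonal
      (fun i => hlam.trans (le_leadingDiag_entry hs.antitone hr' i)) _

end EigenSplit

/-! ### The orthogonal Procrustes problem -/

section Procrustes

variable {n r : ℕ}

open scoped Matrix.Norms.Frobenius in
theorem matNormFro_nonneg {m k : Type*} [Fintype m] [Fintype k] (B : Matrix m k ℝ) :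
    0 ≤ matNormFro B := norm_nonneg _

theorem matNormFro_sq {m k : Type*} [Fintype m] [Fintype k] (B : Matrix m k ℝ) :
    matNormFro B ^ 2 = (Bᵀ * B).trace := by
  unfold matNormFro
  rw [Matrix.frobenius_norm_def, ← Real.sqrt_eq_rpow, Real.sq_sqrt (by positivity),
    Matrix.trace, Finset.sum_comm]
  refine Finset.sum_congr rfl fun j _ => ?_
  rw [Matrix.diag_apply, Matrix.mul_apply]
  refine Finset.sum_congr rfl fun i _ => ?_
  rw [Matrix.transpose_apply, ← sq]
  simp

/-- A solution `U` of the Procrustes problem maximizes `tr (Vᵀ W Q)` over orthogonal `Q`. -/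
theorem IsProcrustesSolution.trace_mul_le {W V : Matrix (Fin n) (Fin r) ℝ}
    {U Q : Matrix (Fin r) (Fin r) ℝ} (hU : IsProcrustesSolution W V U) (hQ : Qᵀ * Q = 1)
    (hW : Wᵀ * W = 1) : (Vᵀ * W * Q).trace ≤ (Vᵀ * W * U).trace := by
  have hQ' : Q ∈ Matrix.orthogonalGroup (Fin r) ℝ := (Matrix.mem_orthogonalGroup_iff' _ _).2 hQ
  have h := pow_le_pow_left₀ (matNormFro_nonneg _) (hU.2 Q hQ') 2
  have key : ∀ R : Matrix (Fin r) (Fin r) ℝ, Rᵀ * R = 1 →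
      matNormFro (W * R - V) ^ 2
        = (1 : Matrix (Fin r) (Fin r) ℝ).trace + (Vᵀ * V).trace - 2 * (Vᵀ * W * R).trace := by
    intro R hR
    have h1 : (W * R)ᵀ * (W * R) = 1 := by
      rw [Matrix.transpose_mul, Matrix.mul_assoc, ← Matrix.mul_assoc Wᵀ, hW, Matrix.one_mul, hR]
    have h2 : ((W * R)ᵀ * V).trace = (Vᵀ * W * R).trace := by
      rw [← Matrix.trace_transpose, Matrix.transpose_mul, Matrix.transpose_transpose,
        Matrix.mul_assoc]
    rw [matNormFro_sq, Matrix.transpose_sub, Matrix.sub_mul, Matrix.mul_sub, Matrix.mul_sub, h1,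
      Matrix.trace_sub, Matrix.trace_sub, Matrix.trace_sub, h2, ← Matrix.mul_assoc]
    ring
  rw [key U ((Matrix.mem_orthogonalGroup_iff' _ _).1 hU.1), key Q hQ] at h
  linarith

open scoped MatrixOrder Matrix.Norms.L2Operator in
/-- An invertible real matrix `P` with `tr (P Q) ≤ tr P` for all orthogonal `Q` is positive
semidefinite. With the polar decomposition `P = H Q`, testing against `Qᵀ` gives
`tr H ≤ tr (H Q)`, hence `tr ((1 - Q)ᵀ H (1 - Q)) ≤ 0` and `H Q = H`. -/
theorem posSemidef_of_trace_mul_le {k : Type*} [Fintype k] [DecidableEq k] {P : Matrix k k ℝ}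
    (hP : IsUnit P.det) (h : ∀ Q : Matrix k k ℝ, Qᵀ * Q = 1 → (P * Q).trace ≤ P.trace) :
    P.PosSemidef := by
  have hPP : (P * Pᵀ).PosSemidef := by
    rw [← Matrix.conjTranspose_eq_transpose_of_trivial]
    exact Matrix.posSemidef_self_mul_conjTranspose P
  set H := CFC.sqrt (P * Pᵀ) with hHdef
  have hHH : H * H = P * Pᵀ := CFC.sqrt_mul_sqrt_self _ hPP.nonneg
  have hH : H.PosSemidef := Matrix.nonneg_iff_posSemidef.1 (CFC.sqrt_nonneg (P * Pᵀ))
  have hHt : Hᵀ = H := by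
    rw [← Matrix.conjTranspose_eq_transpose_of_trivial]; exact hH.1
  set R := CFC.sqrt H with hRdef
  have hRR : R * R = H := CFC.sqrt_mul_sqrt_self _ hH.nonneg
  have hRt : Rᵀ = R := by
    rw [← Matrix.conjTranspose_eq_transpose_of_trivial]
    exact (Matrix.nonneg_iff_posSemidef.1 (CFC.sqrt_nonneg H)).1
  have hdet : IsUnit H.det := by
    have := congrArg Matrix.det hHH
    rw [Matrix.det_mul, Matrix.det_mul, Matrix.det_transpose] at this
    exact isUnit_of_mul_isUnit_left (this ▸ hP.mul hP)
  set Q := H⁻¹ * P with hQdef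
  have hHQ : H * Q = P := by rw [hQdef, ← Matrix.mul_assoc, Matrix.mul_nonsing_inv _ hdet,
    Matrix.one_mul]
  have hQQ : Q * Qᵀ = 1 := by
    rw [hQdef, Matrix.transpose_mul, Matrix.transpose_nonsing_inv, hHt, Matrix.mul_assoc,
      ← Matrix.mul_assoc P, ← hHH, Matrix.mul_assoc H, Matrix.mul_nonsing_inv _ hdet,
      Matrix.mul_one, Matrix.nonsing_inv_mul _ hdet]
  have htr : H.trace ≤ (H * Q).trace := by
    have := h Qᵀ (by rw [Matrix.transpose_transpose, hQQ])
    rw [← hHQ, Matrix.mul_assoc, hQQ, Matrix.mul_one] at this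
    exact this
  have hQH : (Qᵀ * H).trace = (H * Q).trace := by
    rw [← Matrix.trace_transpose, Matrix.transpose_mul, Matrix.transpose_transpose, hHt]
  have hQHQ : (Qᵀ * H * Q).trace = H.trace := by
    rw [Matrix.mul_assoc, Matrix.trace_mul_comm, Matrix.mul_assoc, hQQ, Matrix.mul_one]
  have hsq : ((R * (1 - Q))ᴴ * (R * (1 - Q))).trace = 2 * (H.trace - (H * Q).trace) := by
    rw [Matrix.conjTranspose_eq_transpose_of_trivial, Matrix.transpose_mul, hRt,
      Matrix.mul_assoc, ← Matrix.mul_assoc R, hRR, Matrix.transpose_sub, Matrix.transpose_one,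
      Matrix.sub_mul, Matrix.mul_sub, Matrix.one_mul, Matrix.mul_one, Matrix.mul_sub,
      ← Matrix.mul_assoc Qᵀ, Matrix.trace_sub, Matrix.trace_sub, Matrix.trace_sub,
      hQH, hQHQ]
    ring
  have hnn := (Matrix.posSemidef_conjTranspose_mul_self (R * (1 - Q))).trace_nonneg
  have h0 : R * (1 - Q) = 0 := by
    rw [← Matrix.trace_conjTranspose_mul_self_eq_zero_iff]
    linarith
  have hHP : H = P := by
    have : H * (1 - Q) = 0 := by rw [← hRR, Matrix.mul_assoc, h0, Matrix.mul_zero]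
    rw [Matrix.mul_sub, Matrix.mul_one, hHQ] at this
    exact sub_eq_zero.1 this
  exact hHP ▸ hH

/-- For `P` positive semidefinite, `1 - P² = (1 + P) (1 - P)` and `1 + P` does not shrink vectors. -/
theorem matNormTwo_one_sub_le {k : Type*} [Fintype k] [DecidableEq k] {P : Matrix k k ℝ}
    (hP : P.PosSemidef) : matNormTwo (1 - P) ≤ matNormTwo (1 - P * P) := by
  refine matNormTwo_le_of_forall (matNormTwo_nonneg _) fun x => ?_
  have h1 : ∀ y : k → ℝ, 1 * (y ⬝ᵥ y) ≤ y ⬝ᵥ (1 + P) *ᵥ y := fun y => by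
    have := hP.dotProduct_mulVec_nonneg y
    rw [star_trivial] at this
    rw [Matrix.add_mulVec, Matrix.one_mulVec, dotProduct_add, one_mul]
    linarith
  have h2 := mul_norm_le_norm_mulVec h1 ((1 - P) *ᵥ x)
  rw [Matrix.mulVec_mulVec, one_mul] at h2
  have h3 : (1 + P) * (1 - P) = 1 - P * P := by noncomm_ring
  rw [h3] at h2
  exact h2.trans (norm_toLp_mulVec_le _ _)

end Procrustes

/-! ### The separation as a lower bound for the Sylvester operator -/

theorem matSepOn_mul_le {l m k : Type*} [Fintype l] [Fintype m] [Fintype k]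
    (W : Matrix m k ℝ) (B : Matrix l l ℝ) (C : Matrix m m ℝ) (X : Matrix k l ℝ) :
    matSepOn matNormTwoInf W B C * matNormTwoInf (W * X)
      ≤ matNormTwoInf (W * X * B - C * (W * X)) := by
  rcases (matNormTwoInf_nonneg (W * X)).eq_or_lt with h0 | h0
  · rw [← h0, mul_zero]; exact matNormTwoInf_nonneg _
  · set c := matNormTwoInf (W * X) with hc
    have hc' : |c⁻¹| = c⁻¹ := abs_of_pos (inv_pos.2 h0)
    rw [← le_div_iff₀ h0]
    refine csInf_le ⟨0, ?_⟩ ⟨c⁻¹ • (W * X), ⟨c⁻¹ • X, (Matrix.mul_smul _ _ _).symm⟩, ?_, ?_⟩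
    · rintro x ⟨Z, -, -, rfl⟩
      exact matNormTwoInf_nonneg _
    · rw [matNormTwoInf_smul, hc', ← hc, inv_mul_cancel₀ h0.ne']
    · rw [Matrix.smul_mul, Matrix.mul_smul, ← smul_sub, matNormTwoInf_smul, hc', div_eq_inv_mul]

/-! ### Invariant subspaces as graphs over the dominant eigenspace -/

section Graph

variable {n r : ℕ} {h : r ≤ n} {A E : Matrix (Fin n) (Fin n) ℝ} {lam : Fin n → ℝ}
  {V₁ W : Matrix (Fin n) (Fin r) ℝ} {V₂ : Matrix (Fin n) (Fin (n - r)) ℝ}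
  {M : Matrix (Fin r) (Fin r) ℝ}

theorem IsEigenSplit.sylvester_eq (hs : IsEigenSplit h A lam V₁ V₂) (hM : (A + E) * W = W * M) :
    V₂ᵀ * W * M - trailingDiag r lam * (V₂ᵀ * W) = V₂ᵀ * E * W := by
  rw [Matrix.mul_assoc V₂ᵀ W M, ← hM, Matrix.add_mul, Matrix.mul_add, ← Matrix.mul_assoc V₂ᵀ A,
    hs.transpose_mul_trailing, Matrix.mul_assoc (trailingDiag r lam), add_sub_cancel_left,
    Matrix.mul_assoc]

/-- If the invariant subspace of `A + E` spanned by `W` is the graph of `X` in the coordinates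
`V₁, V₂`, then `X` solves an algebraic Riccati equation. -/
theorem IsEigenSplit.riccati (hs : IsEigenSplit h A lam V₁ V₂) (hM : (A + E) * W = W * M)
    {X : Matrix (Fin (n - r)) (Fin r) ℝ} (hC : IsUnit (V₁ᵀ * W).det)
    (hX : V₂ᵀ * W = X * (V₁ᵀ * W)) :
    X * leadingDiag h lam - trailingDiag r lam * X
      = V₂ᵀ * E * V₁ + V₂ᵀ * E * V₂ * X - X * (V₁ᵀ * E * V₁) - X * (V₁ᵀ * E * V₂) * X := by
  set C := V₁ᵀ * W with hCdef
  have hW : W = (V₁ + V₂ * X) * C := by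
    rw [Matrix.add_mul, Matrix.mul_assoc, ← hX, hCdef, ← Matrix.mul_assoc, ← Matrix.mul_assoc,
      ← Matrix.add_mul, hs.mul_transpose_add, Matrix.one_mul]
  have h1 : C * M = leadingDiag h lam * C + V₁ᵀ * E * W := by
    rw [hCdef, Matrix.mul_assoc, ← hM, Matrix.add_mul, Matrix.mul_add, ← Matrix.mul_assoc V₁ᵀ A,
      hs.transpose_mul_leading, Matrix.mul_assoc, Matrix.mul_assoc]
  have h2 := hs.sylvester_eq hM
  rw [hX, Matrix.mul_assoc X C, h1] at h2
  have h3 : (X * leadingDiag h lam - trailingDiag r lam * X) * C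
      = (V₂ᵀ * E * V₁ + V₂ᵀ * E * V₂ * X - X * (V₁ᵀ * E * V₁) - X * (V₁ᵀ * E * V₂) * X) * C := by
    have e1 : (X * leadingDiag h lam - trailingDiag r lam * X) * C
        = V₂ᵀ * E * W - X * (V₁ᵀ * E * W) := by
      rw [← h2, Matrix.mul_add, Matrix.sub_mul, Matrix.mul_assoc, Matrix.mul_assoc]
      abel
    rw [e1]
    have e2 : ∀ G : Matrix (Fin n) (Fin n) ℝ, G * W = G * V₁ * C + G * V₂ * X * C := fun G => by
      conv_lhs => rw [hW]
      simp only [Matrix.mul_assoc, Matrix.add_mul, Matrix.mul_add]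
    have e3 : E * W = E * V₁ * C + E * V₂ * X * C := e2 E
    rw [Matrix.mul_assoc V₂ᵀ, Matrix.mul_assoc V₁ᵀ, e3]
    simp only [Matrix.mul_assoc, Matrix.add_mul, Matrix.mul_add, Matrix.sub_mul]
    abel
  have := congrArg (· * C⁻¹) h3
  simpa only [Matrix.mul_assoc, Matrix.mul_nonsing_inv _ hC, Matrix.mul_one] using this

theorem IsEigenSplit.gram_blocks (hs : IsEigenSplit h A lam V₁ V₂) (hW : Wᵀ * W = 1) :
    (V₁ᵀ * W)ᵀ * (V₁ᵀ * W) + (V₂ᵀ * W)ᵀ * (V₂ᵀ * W) = 1 := by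
  have := hs.mul_transpose_add
  calc _ = Wᵀ * (V₁ * V₁ᵀ + V₂ * V₂ᵀ) * W := by
        simp only [Matrix.transpose_mul, Matrix.transpose_transpose, Matrix.mul_add,
          Matrix.add_mul, Matrix.mul_assoc]
    _ = 1 := by rw [this, Matrix.mul_one, hW]

/-- If `CᵀC + SᵀS = 1` and `S` is small, then `C` is invertible with `‖C⁻¹‖ ≤ 2`, as
`C⁻¹ = Cᵀ + SᵀS C⁻¹`. -/
theorem isUnit_det_and_inv_le {k m : Type*} [Fintype k] [Fintype m] [DecidableEq k]
    [DecidableEq m] {C : Matrix k k ℝ} {S : Matrix m k ℝ} (hCS : Cᵀ * C + Sᵀ * S = 1)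
    (hC1 : matNormTwo C ≤ 1) (hS : matNormTwo S ≤ 1 / 4) :
    IsUnit C.det ∧ matNormTwo C⁻¹ ≤ 2 := by
  have hS2 : matNormTwo (Sᵀ * S) ≤ 1 / 16 := by
    rw [matNormTwo_transpose_mul_self]; nlinarith [matNormTwo_nonneg S]
  have hunit : IsUnit C.det := by
    rw [← Matrix.isUnit_iff_isUnit_det, ← Matrix.mulVec_injective_iff_isUnit]
    rw [← Matrix.coe_mulVecLin, ← LinearMap.ker_eq_bot, LinearMap.ker_eq_bot']
    intro x hx
    rw [Matrix.mulVecLin_apply] at hx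
    have h1 : x = (Sᵀ * S) *ᵥ x := by
      have := congrArg (· *ᵥ x) hCS
      simpa only [Matrix.add_mulVec, ← Matrix.mulVec_mulVec, hx, Matrix.mulVec_zero, zero_add,
        Matrix.one_mulVec] using this.symm
    have h2 := norm_toLp_mulVec_le (Sᵀ * S) x
    rw [← h1] at h2
    have h3 : ‖WithLp.toLp 2 x‖ = 0 := by nlinarith [norm_nonneg (WithLp.toLp 2 x)]
    exact (WithLp.toLp_eq_zero 2).1 (norm_eq_zero.1 h3)
  refine ⟨hunit, ?_⟩
  have h1 : C⁻¹ = Cᵀ + Sᵀ * S * C⁻¹ := by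
    have := congrArg (· * C⁻¹) hCS
    simp only [Matrix.add_mul, Matrix.one_mul] at this
    rw [Matrix.mul_assoc Cᵀ, Matrix.mul_nonsing_inv _ hunit, Matrix.mul_one] at this
    exact this.symm
  have h2 : matNormTwo C⁻¹ ≤ matNormTwo C + matNormTwo (Sᵀ * S) * matNormTwo C⁻¹ := by
    conv_lhs => rw [h1]
    rw [← matNormTwo_transpose C]
    exact (matNormTwo_add_le _ _).trans (add_le_add le_rfl (matNormTwo_mul_le _ _))
  nlinarith [matNormTwo_nonneg C⁻¹]

theorem matNormTwo_conj_le {a b : Type*} [Fintype a] [Fintype b] [DecidableEq a] [DecidableEq b]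
    {m : Type*} [Fintype m] [DecidableEq m] {P : Matrix m a ℝ} {Q : Matrix m b ℝ}
    (G : Matrix m m ℝ) (hP : Pᵀ * P = 1) (hQ : Qᵀ * Q = 1) :
    matNormTwo (Pᵀ * G * Q) ≤ matNormTwo G := by
  have h1 := matNormTwo_le_one_of_transpose_mul_self hP
  have h2 := matNormTwo_le_one_of_transpose_mul_self hQ
  rw [← matNormTwo_transpose] at h1
  calc _ ≤ matNormTwo (Pᵀ * G) * matNormTwo Q := matNormTwo_mul_le _ _
    _ ≤ matNormTwo (Pᵀ * G) := mul_le_of_le_one_right (matNormTwo_nonneg _) h2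
    _ ≤ matNormTwo Pᵀ * matNormTwo G := matNormTwo_mul_le _ _
    _ ≤ _ := mul_le_of_le_one_left (matNormTwo_nonneg _) h1

/-- A Davis–Kahan type bound: a dominant subspace of `A + E` is the graph of a matrix `X` with
`‖X‖₂ ≤ 1/2` over the dominant eigenspace of `A`, once `‖E‖₂` is at most a fifth of the gap. -/
theorem IsEigenSplit.exists_graph (hs : IsEigenSplit h A lam V₁ V₂) (hW : Wᵀ * W = 1)
    (hr : r < n) (hM : (A + E) * W = W * M) {a : ℝ}
    (hMa : ∀ x : Fin r → ℝ, (a - matNormTwo E) * (x ⬝ᵥ x) ≤ x ⬝ᵥ M *ᵥ x)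
    (hgap : 0 < a - lam ⟨r, hr⟩) (hE : matNormTwo E ≤ (a - lam ⟨r, hr⟩) / 5) :
    ∃ X : Matrix (Fin (n - r)) (Fin r) ℝ, IsUnit (V₁ᵀ * W).det ∧
      V₂ᵀ * W = X * (V₁ᵀ * W) ∧ matNormTwo X ≤ 1 / 2 := by
  have hS : matNormTwo (V₂ᵀ * W) ≤ 1 / 4 := by
    have h1 := mul_matNormTwo_le_sylvester hMa
      (fun j => trailingDiag_entry_le hs.antitone hr j (by omega)) (V₂ᵀ * W)
    have h2 := hs.sylvester_eq hM
    rw [trailingDiag] at h2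
    rw [h2] at h1
    have h3 := h1.trans (matNormTwo_conj_le E hs.orthonormal₂ hW)
    nlinarith [matNormTwo_nonneg (V₂ᵀ * W)]
  have hC1 : matNormTwo (V₁ᵀ * W) ≤ 1 := by
    have := (matNormTwo_conj_le 1 hs.orthonormal₁ hW).trans matNormTwo_one_le
    rwa [Matrix.mul_one] at this
  obtain ⟨hu, hinv⟩ := isUnit_det_and_inv_le (hs.gram_blocks hW) hC1 hS
  refine ⟨V₂ᵀ * W * (V₁ᵀ * W)⁻¹, hu, ?_, ?_⟩
  · rw [Matrix.mul_assoc, Matrix.nonsing_inv_mul _ hu, Matrix.mul_one]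
  · refine (matNormTwo_mul_le _ _).trans ?_
    nlinarith [matNormTwo_nonneg (V₂ᵀ * W), matNormTwo_nonneg (V₁ᵀ * W)⁻¹]

/-- Once `‖X‖₂ ≤ 1/2`, the perturbation terms of the Riccati equation total at most
`(2/5 + 1/10) δ ‖X‖₂`, which leaves half of the lower bound for the Sylvester operator. -/
theorem IsEigenSplit.graph_norm_le (hs : IsEigenSplit h A lam V₁ V₂) {δ : ℝ}
    {X : Matrix (Fin (n - r)) (Fin r) ℝ}
    (hsyl : δ * matNormTwo X ≤ matNormTwo (X * leadingDiag h lam - trailingDiag r lam * X))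
    (hE : matNormTwo E ≤ δ / 5) (hX : matNormTwo X ≤ 1 / 2)
    (hric : X * leadingDiag h lam - trailingDiag r lam * X
      = V₂ᵀ * E * V₁ + V₂ᵀ * E * V₂ * X - X * (V₁ᵀ * E * V₁) - X * (V₁ᵀ * E * V₂) * X) :
    δ * matNormTwo X ≤ 2 * matNormTwo (V₂ᵀ * E * V₁) := by
  rw [hric] at hsyl
  set x := matNormTwo X
  set e := matNormTwo E
  have hx : 0 ≤ x := matNormTwo_nonneg _
  have he : 0 ≤ e := matNormTwo_nonneg _
  have t1 : matNormTwo (V₂ᵀ * E * V₂ * X) ≤ e * x :=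
    (matNormTwo_mul_le _ _).trans
      (mul_le_mul_of_nonneg_right (matNormTwo_conj_le E hs.orthonormal₂ hs.orthonormal₂) hx)
  have t2 : matNormTwo (X * (V₁ᵀ * E * V₁)) ≤ x * e :=
    (matNormTwo_mul_le _ _).trans
      (mul_le_mul_of_nonneg_left (matNormTwo_conj_le E hs.orthonormal₁ hs.orthonormal₁) hx)
  have t3 : matNormTwo (X * (V₁ᵀ * E * V₂) * X) ≤ x * e * x :=
    (matNormTwo_mul_le _ _).trans (mul_le_mul_of_nonneg_right ((matNormTwo_mul_le _ _).trans
      (mul_le_mul_of_nonneg_left (matNormTwo_conj_le E hs.orthonormal₁ hs.orthonormal₂) hx)) hx)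
  have s1 := matNormTwo_sub_le (V₂ᵀ * E * V₁ + V₂ᵀ * E * V₂ * X - X * (V₁ᵀ * E * V₁))
    (X * (V₁ᵀ * E * V₂) * X)
  have s2 := matNormTwo_sub_le (V₂ᵀ * E * V₁ + V₂ᵀ * E * V₂ * X) (X * (V₁ᵀ * E * V₁))
  have s3 := matNormTwo_add_le (V₂ᵀ * E * V₁) (V₂ᵀ * E * V₂ * X)
  have q1 : x * e * x ≤ x * e * (1 / 2) := mul_le_mul_of_nonneg_left hX (mul_nonneg hx he)
  have q2 : x * e ≤ x * (δ / 5) := mul_le_mul_of_nonneg_left hE hx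
  linarith

/-- Multiplied by `V₂`, the Riccati equation becomes an equation for `Z = V₂ X`, and `‖X‖₂ ≤ 1/2`
already makes its quadratic term small. The term `V₂ V₂ᵀ E Z` is the only one that needs the bound
on `‖E‖_∞`: it costs a factor `‖V₂ V₂ᵀ‖_∞ = ‖1 - V₁ V₁ᵀ‖_∞ ≤ 1 + μ²`. In total the perturbation
terms are at most `(1/4 + 1/5 + 1/10) g ‖Z‖`. -/
theorem IsEigenSplit.graph_rows_le (hs : IsEigenSplit h A lam V₁ V₂) {g : ℝ}
    {X : Matrix (Fin (n - r)) (Fin r) ℝ}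
    (hg : g ≤ matSepOn matNormTwoInf V₂ (leadingDiag h lam) (V₂ * trailingDiag r lam * V₂ᵀ))
    (hE : matNormTwo E ≤ g / 5) (hX : matNormTwo X ≤ 1 / 2)
    (hEinf : matNormInf E ≤ g / (4 + 4 * (Real.sqrt n * matNormTwoInf V₁) ^ 2))
    (hric : X * leadingDiag h lam - trailingDiag r lam * X
      = V₂ᵀ * E * V₁ + V₂ᵀ * E * V₂ * X - X * (V₁ᵀ * E * V₁) - X * (V₁ᵀ * E * V₂) * X) :
    g * matNormTwoInf (V₂ * X) ≤ 4 * matNormTwoInf (V₂ * (V₂ᵀ * E * V₁)) := by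
  set Z := V₂ * X with hZ
  set z := matNormTwoInf Z with hz
  set e := matNormTwo E
  have hz0 : 0 ≤ z := matNormTwoInf_nonneg _
  have he : 0 ≤ e := matNormTwo_nonneg _
  have hsep : g * z ≤ matNormTwoInf (Z * leadingDiag h lam - V₂ * trailingDiag r lam * V₂ᵀ * Z) :=
    (mul_le_mul_of_nonneg_right hg hz0).trans (matSepOn_mul_le _ _ _ _)
  have hT : Z * leadingDiag h lam - V₂ * trailingDiag r lam * V₂ᵀ * Z
      = V₂ * (V₂ᵀ * E * V₁) + V₂ * V₂ᵀ * E * Z + -(Z * (V₁ᵀ * E * V₁))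
        + -(Z * (V₁ᵀ * E * V₂) * X) := by
    have h1 : Z * leadingDiag h lam - V₂ * trailingDiag r lam * V₂ᵀ * Z
        = V₂ * (X * leadingDiag h lam - trailingDiag r lam * X) := by
      rw [hZ, Matrix.mul_assoc _ V₂ᵀ, ← Matrix.mul_assoc V₂ᵀ, hs.orthonormal₂, Matrix.one_mul,
        Matrix.mul_sub, Matrix.mul_assoc, Matrix.mul_assoc]
    rw [h1, hric, hZ]
    simp only [Matrix.mul_sub, Matrix.mul_add, Matrix.mul_assoc]
    abel
  rw [hT] at hsep
  have t1 : matNormTwoInf (V₂ * V₂ᵀ * E * Z) ≤ g / 4 * z := by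
    refine (matNormTwoInf_mul_le_matNormInf_mul _ _).trans (mul_le_mul_of_nonneg_right ?_ hz0)
    have hproj : matNormInf (V₂ * V₂ᵀ) ≤ 1 + (Real.sqrt n * matNormTwoInf V₁) ^ 2 := by
      rw [eq_sub_of_add_eq' hs.mul_transpose_add]
      refine (matNormInf_sub_le _ _).trans (add_le_add (matNormInf_le zero_le_one fun i => ?_) ?_)
      · simp [Matrix.one_apply, apply_ite abs]
      · simpa using matNormInf_mul_transpose_self_le V₁
    refine (matNormInf_mul_le _ _).trans ((mul_le_mul hproj hEinf (matNormInf_nonneg _)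
      (by positivity)).trans_eq ?_)
    field_simp
  have t2 : matNormTwoInf (Z * (V₁ᵀ * E * V₁)) ≤ z * e :=
    (matNormTwoInf_mul_le_mul_matNormTwo _ _).trans
      (mul_le_mul_of_nonneg_left (matNormTwo_conj_le E hs.orthonormal₁ hs.orthonormal₁) hz0)
  have t3 : matNormTwoInf (Z * (V₁ᵀ * E * V₂) * X) ≤ z * e * (1 / 2) :=
    (matNormTwoInf_mul_le_mul_matNormTwo _ _).trans (mul_le_mul
      ((matNormTwoInf_mul_le_mul_matNormTwo _ _).trans
        (mul_le_mul_of_nonneg_left (matNormTwo_conj_le E hs.orthonormal₁ hs.orthonormal₂) hz0))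
      hX (matNormTwo_nonneg _) (mul_nonneg hz0 he))
  have s1 := matNormTwoInf_add_le (V₂ * (V₂ᵀ * E * V₁) + V₂ * V₂ᵀ * E * Z + -(Z * (V₁ᵀ * E * V₁)))
    (-(Z * (V₁ᵀ * E * V₂) * X))
  have s2 := matNormTwoInf_add_le (V₂ * (V₂ᵀ * E * V₁) + V₂ * V₂ᵀ * E * Z) (-(Z * (V₁ᵀ * E * V₁)))
  have s3 := matNormTwoInf_add_le (V₂ * (V₂ᵀ * E * V₁)) (V₂ * V₂ᵀ * E * Z)
  rw [matNormTwoInf_neg] at s1 s2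
  have q : z * e ≤ z * (g / 5) := mul_le_mul_of_nonneg_left hE hz0
  have hg0 : 0 ≤ g * z := mul_nonneg (by linarith) hz0
  linarith

/-- After Procrustes alignment, the error splits into a component in the range of `V₁`, of second
order in `X`, and the component `V₂ X`. The aligned cosine block `P = V₁ᵀ W U` is positive
semidefinite and `1 - P² = (V₂ᵀ W U)ᵀ (V₂ᵀ W U)`, so `‖1 - P‖₂ ≤ ‖X‖₂²`. -/
theorem IsEigenSplit.procrustes_error_le (hs : IsEigenSplit h A lam V₁ V₂) (hW : Wᵀ * W = 1)
    {X : Matrix (Fin (n - r)) (Fin r) ℝ} (hC : IsUnit (V₁ᵀ * W).det)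
    (hX : V₂ᵀ * W = X * (V₁ᵀ * W)) {U : Matrix (Fin r) (Fin r) ℝ}
    (hU : IsProcrustesSolution W V₁ U) :
    matNormTwoInf (W * U - V₁)
      ≤ matNormTwoInf V₁ * matNormTwo X ^ 2 + matNormTwoInf (V₂ * X) := by
  have hUU : Uᵀ * U = 1 := (Matrix.mem_orthogonalGroup_iff' _ _).1 hU.1
  have hWU : (W * U)ᵀ * (W * U) = 1 := by
    rw [Matrix.transpose_mul, Matrix.mul_assoc, ← Matrix.mul_assoc Wᵀ, hW, Matrix.one_mul, hUU]
  set P := V₁ᵀ * (W * U) with hP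
  have hXP : V₂ᵀ * (W * U) = X * P := by
    rw [hP, ← Matrix.mul_assoc, hX, Matrix.mul_assoc, Matrix.mul_assoc]
  have hPpsd : P.PosSemidef := by
    refine posSemidef_of_trace_mul_le ?_ fun Q hQ => ?_
    · rw [hP, ← Matrix.mul_assoc, Matrix.det_mul]
      exact hC.mul (Matrix.isUnit_det_of_left_inverse hUU)
    · have h1 := hU.trace_mul_le (Q := U * Q) (by
        rw [Matrix.transpose_mul, Matrix.mul_assoc, ← Matrix.mul_assoc Uᵀ, hUU, Matrix.one_mul,
          hQ]) hW
      simpa only [hP, Matrix.mul_assoc] using h1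
  have hP1 : matNormTwo P ≤ 1 := by
    have := (matNormTwo_conj_le 1 hs.orthonormal₁ hWU).trans matNormTwo_one_le
    rwa [Matrix.mul_one] at this
  have hPt : Pᵀ = P := by
    rw [← Matrix.conjTranspose_eq_transpose_of_trivial]; exact hPpsd.1
  have hgram := hs.gram_blocks hWU
  rw [← hP, hXP, hPt] at hgram
  have h1P : matNormTwo (P - 1) ≤ matNormTwo X ^ 2 := by
    have h1 := matNormTwo_one_sub_le hPpsd
    rw [← eq_sub_of_add_eq' hgram, matNormTwo_transpose_mul_self] at h1
    have h2 : matNormTwo (X * P) ≤ matNormTwo X :=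
      (matNormTwo_mul_le _ _).trans (mul_le_of_le_one_right (matNormTwo_nonneg _) hP1)
    have h3 : P - 1 = (-1 : ℝ) • (1 - P) := by rw [neg_one_smul, neg_sub]
    rw [h3, matNormTwo_smul, abs_neg, abs_one, one_mul]
    exact h1.trans (pow_le_pow_left₀ (matNormTwo_nonneg _) h2 2)
  have hdec : W * U - V₁ = V₁ * (P - 1) + V₂ * X * P := by
    rw [Matrix.mul_assoc, ← hXP, hP, Matrix.mul_sub, Matrix.mul_one, ← Matrix.mul_assoc V₂,
      ← Matrix.mul_assoc V₁, sub_add_eq_add_sub, ← Matrix.add_mul, hs.mul_transpose_add,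
      Matrix.one_mul]
  rw [hdec]
  refine (matNormTwoInf_add_le _ _).trans (add_le_add ?_ ?_)
  · exact (matNormTwoInf_mul_le_mul_matNormTwo _ _).trans
      (mul_le_mul_of_nonneg_left h1P (matNormTwoInf_nonneg _))
  · exact (matNormTwoInf_mul_le_mul_matNormTwo _ _).trans
      (mul_le_of_le_one_right (matNormTwoInf_nonneg _) hP1)

end Graph

/-! ### The aligned rowwise error -/

theorem corollary3p3 {n r : ℕ} (hr : 0 < r) (hrn : r < n)
    (A E : Matrix (Fin n) (Fin n) ℝ) (hA : A.IsSymm) (hE : E.IsSymm)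
    (lam : Fin n → ℝ)
    (V₁ : Matrix (Fin n) (Fin r) ℝ) (V₂ : Matrix (Fin n) (Fin (n - r)) ℝ)
    (hsplit : IsEigenSplit hrn.le A lam V₁ V₂)
    (hlam : lam ⟨r, hrn⟩ < lam ⟨r - 1, (Nat.sub_le r 1).trans_lt hrn⟩)
    (gap : ℝ) (hgap : gap = spectralGap hrn.le lam V₂)
    (μ : ℝ) (hμ : μ = Real.sqrt n * matNormTwoInf V₁)
    (hE₂ : matNormTwo E ≤ gap / 5)
    (hEinf : matNormInf E ≤ gap / (4 + 4 * μ ^ 2))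
    (Vhat₁ : Matrix (Fin n) (Fin r) ℝ) (hVhat : IsDominantBasis hrn.le (A + E) Vhat₁)
    (Utilde : Matrix (Fin r) (Fin r) ℝ) (hU : IsProcrustesSolution Vhat₁ V₁ Utilde)
    (E₂₁ : Matrix (Fin (n - r)) (Fin r) ℝ) (hE₂₁ : E₂₁ = V₂.transpose * E * V₁) :
    matNormTwoInf (Vhat₁ * Utilde - V₁) ≤
      8 * matNormTwoInf V₁ *
          (matNormTwo E₂₁ / matSep matNormTwo (leadingDiag hrn.le lam) (trailingDiag r lam)) ^ 2 +
        4 * (matNormTwoInf (V₂ * E₂₁) / gap) := by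
  subst hμ hE₂₁
  have hr' : r - 1 < n := (Nat.sub_le r 1).trans_lt hrn
  have hsep := matSep_matNormTwo_eq hsplit.antitone hr hrn hr'
  rw [hsep]
  set δ := lam ⟨r - 1, hr'⟩ - lam ⟨r, hrn⟩ with hδ
  have hδ0 : 0 < δ := sub_pos.2 hlam
  have hgδ : gap ≤ δ := by rw [hgap, ← hsep]; exact min_le_left _ _
  have hgOn : gap ≤ matSepOn matNormTwoInf V₂ (leadingDiag hrn.le lam)
      (V₂ * trailingDiag r lam * V₂ᵀ) := by rw [hgap]; exact min_le_right _ _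
  have hEδ : matNormTwo E ≤ δ / 5 := hE₂.trans (by linarith)
  have hΛ : ∀ x : Fin r → ℝ,
      lam ⟨r - 1, hr'⟩ * (x ⬝ᵥ x) ≤ x ⬝ᵥ leadingDiag hrn.le lam *ᵥ x :=
    mul_dotProduct_le_diagonal fun i => le_leadingDiag_entry (h := hrn.le) hsplit.antitone hr' i
  -- `A + E` is at least `λ_r - ‖E‖₂` on the range of `V₁`.
  have hquad : ∀ x : Fin r → ℝ, (lam ⟨r - 1, hr'⟩ - matNormTwo E) * (x ⬝ᵥ x)
      ≤ (V₁ *ᵥ x) ⬝ᵥ (A + E) *ᵥ (V₁ *ᵥ x) := by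
    intro x
    have h1 : (V₁ *ᵥ x) ⬝ᵥ A *ᵥ (V₁ *ᵥ x) = x ⬝ᵥ leadingDiag hrn.le lam *ᵥ x := by
      rw [Matrix.mulVec_mulVec, hsplit.mul_leading, ← Matrix.mulVec_mulVec,
        Matrix.dotProduct_mulVec, ← Matrix.mulVec_transpose, Matrix.mulVec_mulVec,
        hsplit.orthonormal₁, Matrix.one_mulVec]
    have h2 := (abs_le.1 (abs_dotProduct_le (V₁ *ᵥ x) (E *ᵥ (V₁ *ᵥ x)))).1
    have h3 := mul_le_mul_of_nonneg_left (norm_toLp_mulVec_le E (V₁ *ᵥ x))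
      (norm_nonneg (WithLp.toLp 2 (V₁ *ᵥ x)))
    have h4 : x ⬝ᵥ x = ‖WithLp.toLp 2 (V₁ *ᵥ x)‖ ^ 2 := by
      rw [← dotProduct_self_eq_norm_toLp_sq, mulVec_dotProduct_mulVec_self hsplit.orthonormal₁]
    rw [Matrix.add_mulVec, dotProduct_add, h1]
    have h5 := hΛ x
    have h6 : matNormTwo E * (x ⬝ᵥ x) = ‖WithLp.toLp 2 (V₁ *ᵥ x)‖
        * (matNormTwo E * ‖WithLp.toLp 2 (V₁ *ᵥ x)‖) := by rw [h4]; ring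
    rw [sub_mul, h6]
    linarith
  have hW := hVhat.1
  obtain ⟨M, hM, hMa⟩ := hVhat.exists_mul_eq hr hsplit.orthonormal₁ hquad
  obtain ⟨X, hC, hX, hX2⟩ := hsplit.exists_graph hW hrn hM hMa hδ0 hEδ
  have hric := hsplit.riccati hM hC hX
  have hsyl : δ * matNormTwo X
      ≤ matNormTwo (X * leadingDiag hrn.le lam - trailingDiag r lam * X) :=
    mul_matNormTwo_le_sylvester hΛ
      (fun j => trailingDiag_entry_le hsplit.antitone hrn j (by omega)) X
  have hx := hsplit.graph_norm_le hsyl hEδ hX2 hric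
  have hz := hsplit.graph_rows_le hgOn hE₂ hX2 hEinf hric
  have hx' : matNormTwo X ≤ 2 * (matNormTwo (V₂ᵀ * E * V₁) / δ) := by
    rw [← mul_div_assoc, le_div_iff₀' hδ0]; exact hx
  have hz' : matNormTwoInf (V₂ * X) ≤ 4 * (matNormTwoInf (V₂ * (V₂ᵀ * E * V₁)) / gap) := by
    have hg0 : 0 ≤ gap := by linarith [matNormTwo_nonneg E]
    rcases hg0.eq_or_lt with h0 | h0
    -- If the gap vanishes, the division is by zero; but then `E = 0` and `X = 0`.
    · have hE0 : E = 0 := matNormTwo_eq_zero.1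
        (le_antisymm (by rw [← h0] at hE₂; simpa using hE₂) (matNormTwo_nonneg _))
      have hX0 : X = 0 := matNormTwo_eq_zero.1
        (le_antisymm (by rw [hE0] at hx'; simpa [matNormTwo_eq_zero.2] using hx')
          (matNormTwo_nonneg _))
      rw [hX0, ← h0, Matrix.mul_zero, div_zero, mul_zero]
      exact matNormTwoInf_le le_rfl fun i => (norm_zero (E := EuclideanSpace ℝ (Fin r))).le
    · rw [← mul_div_assoc, le_div_iff₀' h0]; exact hz
  refine (hsplit.procrustes_error_le hW hC hX hU).trans (add_le_add ?_ hz')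
  rw [mul_comm 8, mul_assoc]
  refine mul_le_mul_of_nonneg_left ?_ (matNormTwoInf_nonneg _)
  have := pow_le_pow_left₀ (matNormTwo_nonneg X) hx' 2
  nlinarith [sq_nonneg (matNormTwo (V₂ᵀ * E * V₁) / δ)]
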